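/- Let $S$ be a right amenable group (or cancellative monoid), let $A$ be a (discrete) abelian group, and let $\alpha\colon S\to\mathrm{End}(A)$ be a left action of $S$ on $A$ by endomorphisms. A right F\o lner net of $S$ is a net $(F_i)_{i\in I}$ of non-empty finite subsets of $S$ such that $|F_is\setminus F_i|/|F_i|\to 0$ for every $s\in S$. For a non-empty finite subset $X$ of $A$ put $$H_{alg}(\alpha,X)=\lim_{i\in I}\frac{\log\left|\sum_{s\in F_i}\alpha(s)(X)\right|}{|F_i|},$$ where $(F_i)_{i\in I}$ is a right F\o lner net of $S$ (such nets exist, and the limit exists and does not depend on the choice of the net). The algebraic entropy of $\alpha$ is $$h_{alg}(\alpha)=\sup\{H_{alg}(\alpha,X): X\subseteq A \text{ finite and non-empty}\}.$$ Let $K$ be an infinite field. (a) For every integer $n\ge 1$, let $G$ be the subgroup of $\mathrm{GL}_n(K)$ of upper triangular matrices, and let $\alpha$ be the natural action of $G$ on the abelian group $K^n$. Then $G$ is right amenable, the algebraic entropy $h_{alg}(\alpha)$ is defined in the above sense, and $h_{alg}(\alpha)=0$. (b) Let $\lambda$ be the action of the multiplicative group $K^*$ on the additive group of $K$ by multiplication.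 Then $K^*$ is right amenable, the algebraic entropy $h_{alg}(\lambda)$ is defined in the above sense, and $h_{alg}(\lambda)=0$. -/

import Mathlib

open Filter Topology
open scoped Pointwise

universe u v w

namespace AlgEntropy

/-- A semigroup `S` is right amenable: there is a finitely additive probability measure `μ`, defined
on all subsets of `S`, with `μ (R_s ⁻¹ E) = μ E` for every right multiplication `R_s : x ↦ x * s`. -/
def IsRightAmenable (S : Type u) [Semigroup S] : Prop :=
  ∃ μ : Set S → ℝ,
    (∀ E, 0 ≤ μ E ∧ μ E ≤ 1) ∧ μ Set.univ = 1 ∧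
    (∀ E F : Set S, Disjoint E F → μ (E ∪ F) = μ E + μ F) ∧
    (∀ (s : S) (E : Set S), μ ((fun x => x * s) ⁻¹' E) = μ E)

/-- A net `(F i)` (indexed by a directed set) of non-empty finite subsets of `S` is a right Følner
net if `|F i s \ F i| / |F i| → 0` for every `s`. -/
def IsRightFolnerNet {S : Type u} [Semigroup S] {I : Type w} [Preorder I]
    (F : I → Finset S) : Prop :=
  (∀ i, (F i).Nonempty) ∧
    ∀ s : S, Tendsto
      (fun i => (((fun x => x * s) '' (F i : Set S) \ (F i : Set S)).ncard : ℝ) / ((F i).card : ℝ))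
      atTop (𝓝 0)

section Entropy

variable {S : Type u} [Monoid S] {A : Type v} [AddCommGroup A]

/-- The trajectory `T_F(α, X) = ∑_{s ∈ F} α(s)(X)`, a sum of subsets of `A`. -/
def trajectory (α : S →* AddMonoid.End A) (F : Finset S) (X : Finset A) : Set A :=
  ∑ s ∈ F, (α s : A → A) '' (X : Set A)

/-- `log |T_F(α, X)| / |F|`. -/
noncomputable def averageGrowth (α : S →* AddMonoid.End A) (X : Finset A) (F : Finset S) : ℝ :=
  Real.log ((trajectory α F X).ncard : ℝ) / (F.card : ℝ)

/-- `L` is the limit of `log |T_{F i}(α, X)| / |F i|` along every right Følner net of `S`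
that is indexed by a type in the universe `w`. -/
def IsEntropyLimit (α : S →* AddMonoid.End A) (X : Finset A) (L : ℝ) : Prop :=
  ∀ (I : Type w) [Preorder I] [IsDirectedOrder I] [Nonempty I] (F : I → Finset S),
    IsRightFolnerNet F → Tendsto (fun i => averageGrowth α X (F i)) atTop (𝓝 L)

/-- `H_alg(α, X)`: the common limit of `log |T_{F i}(α, X)| / |F i|` along the right Følner nets
of `S`. It is meaningful as soon as `EntropyDefined α` holds. -/
noncomputable def entropyOn (α : S →* AddMonoid.End A) (X : Finset A) : ℝ :=
  Classical.epsilon fun L => IsEntropyLimit.{u, v, u} α X L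

/-- The algebraic entropy `h_alg(α)`: the supremum of `H_alg(α, X)` over the non-empty finite
subsets `X` of `A`. -/
noncomputable def algEntropy (α : S →* AddMonoid.End A) : EReal :=
  ⨆ X : {X : Finset A // X.Nonempty}, (entropyOn α X.1 : EReal)

/-- The algebraic entropy of `α` is defined: `S` is right amenable, it has a right Følner net, and
for every non-empty finite `X` the limit that defines `H_alg(α, X)` exists along every
right Følner net and does not depend on the net. -/
def EntropyDefined (α : S →* AddMonoid.End A) : Prop :=
  IsRightAmenable S ∧
  (∃ (I : Type u) (_ : Preorder I) (_ : IsDirectedOrder I) (_ : Nonempty I) (F : I → Finset S),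
    IsRightFolnerNet F) ∧
  ∀ X : Finset A, X.Nonempty → IsEntropyLimit.{u, v, w} α X (entropyOn α X)

end Entropy

section Actions

variable (K : Type u) [Field K] (n : ℕ)

/-- The subgroup of upper triangular matrices of `GL_n(K)`. -/
def upperTriangular : Subgroup (Matrix.GeneralLinearGroup (Fin n) K) where
  carrier := {g | ∀ i j : Fin n, j < i → (g : Matrix (Fin n) (Fin n) K) i j = 0}
  one_mem' := by
    intro i j hij
    simp [hij.ne']
  mul_mem' := by
    intro a b ha hb
    have h1 : Matrix.BlockTriangular (a : Matrix (Fin n) (Fin n) K) id := fun i j h => ha i j h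
    have h2 : Matrix.BlockTriangular (b : Matrix (Fin n) (Fin n) K) id := fun i j h => hb i j h
    intro i j hij
    exact h1.mul h2 hij
  inv_mem' := by
    intro a ha
    have h1 : Matrix.BlockTriangular (a : Matrix (Fin n) (Fin n) K) id := fun i j h => ha i j h
    have : Invertible (a : Matrix (Fin n) (Fin n) K) := a.invertible
    have h2 := Matrix.blockTriangular_inv_of_blockTriangular h1
    intro i j hij
    rw [Matrix.coe_units_inv]
    exact h2 hij

/-- The natural action of the upper triangular subgroup of `GL_n(K)` on `K^n`, `g • v = g v`. -/
def upperTriangularAction : upperTriangular K n →* AddMonoid.End (Fin n → K) where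
  toFun g :=
    { toFun := fun x => Matrix.mulVec (g.1 : Matrix (Fin n) (Fin n) K) x
      map_zero' := Matrix.mulVec_zero _
      map_add' := fun x y => Matrix.mulVec_add _ x y }
  map_one' := by
    refine AddMonoidHom.ext fun x => ?_
    exact Matrix.one_mulVec x
  map_mul' := by
    intro g h
    refine AddMonoidHom.ext fun x => ?_
    exact (Matrix.mulVec_mulVec x _ _).symm

/-- The action of the multiplicative group `K^*` on the additive group of `K` by multiplication. -/
def multiplicationAction : Kˣ →* AddMonoid.End K where
  toFun a :=
    { toFun := fun x => (a : K) * x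
      map_zero' := mul_zero _
      map_add' := fun x y => mul_add _ x y }
  map_one' := by
    refine AddMonoidHom.ext fun x => ?_
    exact one_mul x
  map_mul' := by
    intro a b
    refine AddMonoidHom.ext fun x => ?_
    exact mul_assoc _ _ x

end Actions

end AlgEntropy

/-! Since averages are non-negative, only an upper bound is needed, and tiles give it. If `E` tiles
`G` by left translates `c E`, a finite set `F` with small boundary meets about `|F|/|E|` translates.
The trajectory over each translate is an image under `α c` of the one over `E`, so the average
growth on `F` is asymptotically at most that on `E` (`IsTile.averageGrowth_le`). Thus one tile of
small growth for each `ε` suffices (`isEntropyLimit_zero`).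

Both groups contain `Kˣ` as scalars, and a tile of a subgroup tiles the whole group (`IsTile.map`).
For scalars, sorting the terms of a trajectory by the vector `x ∈ X` writes the sum as `∑ c x • x`,
where each `c x` is a subset sum of `E`. It remains to find tiles `E` of `Kˣ` whose subset sums lie
in a set `R` with `log |R| = o(|E|)` (`hasTilesWithFewSums`): the boxes `2^i 3^j` in characteristic
zero, the boxes `t^i (t-1)^j` when `t` is transcendental over the prime field, and `Lˣ` for large
finite subfields `L` otherwise.

Amenability and the existence of nets come from the Følner condition, which holds for solvable
groups by extension from abelian ones. -/

namespace AlgEntropy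

/-! ### Tiles of a group and coverings by their translates -/

section Tiles

variable {G : Type u} [Group G]

/-- A finite subset `E` of a group is a tile if the group is a disjoint union of left translates
of `E`. -/
def IsTile (E : Finset G) : Prop :=
  ∃ C : Set G, ∀ g : G, ∃! c, c ∈ C ∧ c⁻¹ * g ∈ E

theorem IsTile.nonempty {E : Finset G} (hE : IsTile E) : E.Nonempty := by
  obtain ⟨C, hC⟩ := hE
  obtain ⟨c, ⟨-, hc⟩, -⟩ := hC 1
  exact ⟨_, hc⟩

/-- Tiles are preserved by injective homomorphisms. -/
theorem IsTile.map {H : Type v} [Group H] {E : Finset H} (hE : IsTile E) (φ : H →* G)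
    (hφ : Function.Injective φ) : IsTile (E.map ⟨φ, hφ⟩) := by
  obtain ⟨C, hC⟩ := hE
  -- Coset representatives of `φ.range`: the translates of the image tile are placed at `r q * φ c`.
  choose r hr using fun q : G ⧸ φ.range => QuotientGroup.mk_surjective q
  refine ⟨{g | ∃ q, ∃ c ∈ C, g = r q * φ c}, fun g => ?_⟩
  obtain ⟨h, hh⟩ : (r (g : G ⧸ φ.range))⁻¹ * g ∈ φ.range := QuotientGroup.eq.1 (hr _)
  obtain ⟨c, ⟨hc, hcE⟩, huniq⟩ := hC h
  refine ⟨r (g : G ⧸ φ.range) * φ c, ⟨⟨_, c, hc, rfl⟩, ?_⟩, ?_⟩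
  · rw [Finset.mem_map]
    refine ⟨_, hcE, ?_⟩
    simp [hh, mul_assoc]
  · rintro _ ⟨⟨q, c', hc', rfl⟩, hmem⟩
    obtain ⟨e, he, hee⟩ := Finset.mem_map.1 hmem
    have hee' : φ e = (r q * φ c')⁻¹ * g := hee
    have hg : g = r q * φ (c' * e) := by
      rw [map_mul, hee']; group
    have hq : (g : G ⧸ φ.range) = q := by
      rw [← hr q]
      refine (QuotientGroup.eq.2 ?_).symm
      exact ⟨c' * e, by rw [hg]; group⟩
    have hh' : h = c' * e := by
      apply hφ
      rw [hh, hq]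
      conv_lhs => rw [hg]
      group
    rw [hq, huniq c' ⟨hc', by rw [hh']; simpa using he⟩]

open Classical in
/-- A finite set `F` is covered by translates of a tile `E`, whose number is controlled by the
boundary of `F`. -/
theorem IsTile.exists_cover {E : Finset G} (hE : IsTile E) (F : Finset G) :
    ∃ κ : G → G, (∀ g, (κ g)⁻¹ * g ∈ E) ∧
      (F.image κ).card * E.card ≤
        F.card + ∑ p ∈ E ×ˢ E, ((F.image fun x => x * (p.1⁻¹ * p.2)) \ F).card := by
  obtain ⟨C, hC⟩ := hE
  choose κ hκ huniq using hC
  refine ⟨κ, fun g => (hκ g).2, ?_⟩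
  have hcard : (F.image κ * E).card = (F.image κ).card * E.card := by
    rw [Finset.card_mul_iff]
    rintro ⟨c, e⟩ hce ⟨c', e'⟩ hce' h
    simp only [Set.mem_prod, Finset.mem_coe, Finset.mem_image] at hce hce' h
    obtain ⟨⟨x, -, rfl⟩, he⟩ := hce
    obtain ⟨⟨x', -, rfl⟩, he'⟩ := hce'
    have h1 := huniq (κ x * e) (κ x) ⟨(hκ x).1, by simpa using he⟩
    have h2 := huniq (κ x * e) (κ x') ⟨(hκ x').1, by rw [h]; simpa using he'⟩
    have h3 : κ x = κ x' := h1.trans h2.symm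
    rw [h3] at h
    exact Prod.ext h3 (mul_left_cancel h)
  rw [← hcard]
  -- A point `κ x * e` outside `F` is `x * (p.1⁻¹ * p.2)` with `p = ((κ x)⁻¹ * x, e)`, so it lies in
  -- one of finitely many right boundaries of `F`.
  have hsub : F.image κ * E ⊆
      F ∪ (E ×ˢ E).biUnion fun p => (F.image fun x => x * (p.1⁻¹ * p.2)) \ F := by
    intro y hy
    obtain ⟨c, hc, e, he, rfl⟩ := Finset.mem_mul.1 hy
    obtain ⟨x, hx, rfl⟩ := Finset.mem_image.1 hc
    rw [Finset.mem_union]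
    by_cases hF : κ x * e ∈ F
    · exact Or.inl hF
    · right
      rw [Finset.mem_biUnion]
      refine ⟨((κ x)⁻¹ * x, e), Finset.mk_mem_product (hκ x).2 he, ?_⟩
      rw [Finset.mem_sdiff]
      refine ⟨Finset.mem_image.2 ⟨x, hx, ?_⟩, hF⟩
      group
  calc _ ≤ _ := Finset.card_le_card hsub
    _ ≤ _ := Finset.card_union_le _ _
    _ ≤ _ := by gcongr; exact Finset.card_biUnion_le

end Tiles

/-! ### Cardinalities of trajectories -/

section Trajectories

variable {S : Type u} [Monoid S] {A : Type v} [AddCommGroup A]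

open Classical in
/-- The trajectory as a finite set. -/
noncomputable def trajectoryFinset (α : S →* AddMonoid.End A) (F : Finset S) (X : Finset A) :
    Finset A :=
  ∑ s ∈ F, X.image (α s)

theorem coe_trajectoryFinset (α : S →* AddMonoid.End A) (F : Finset S) (X : Finset A) :
    (trajectoryFinset α F X : Set A) = trajectory α F X := by
  classical
  simp [trajectoryFinset, trajectory, Finset.coe_sum]

theorem averageGrowth_eq (α : S →* AddMonoid.End A) (F : Finset S) (X : Finset A) :
    averageGrowth α X F = Real.log (trajectoryFinset α F X).card / F.card := by
  rw [averageGrowth, ← coe_trajectoryFinset, Set.ncard_coe_finset]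

theorem trajectoryFinset_nonempty (α : S →* AddMonoid.End A) (F : Finset S) {X : Finset A}
    (hX : X.Nonempty) : (trajectoryFinset α F X).Nonempty := by
  classical
  obtain ⟨x, hx⟩ := hX
  rw [trajectoryFinset]
  induction F using Finset.induction_on with
  | empty => simp
  | insert s F hs ih =>
    rw [Finset.sum_insert hs]
    exact Finset.Nonempty.add ⟨_, Finset.mem_image_of_mem _ hx⟩ ih

theorem trajectoryFinset_card_mono (α : S →* AddMonoid.End A) {F F' : Finset S} (h : F ⊆ F')
    {X : Finset A} (hX : X.Nonempty) :
    (trajectoryFinset α F X).card ≤ (trajectoryFinset α F' X).card := by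
  classical
  have : trajectoryFinset α F' X = trajectoryFinset α (F' \ F) X + trajectoryFinset α F X :=
    (Finset.sum_sdiff h).symm
  rw [this]
  exact Finset.card_le_card_add_left (trajectoryFinset_nonempty α _ hX)

-- The trajectory over `c E` is the image of the trajectory over `E` under the endomorphism `α c`,
-- which need not be known to be injective.
open Classical in
theorem trajectoryFinset_image_mul_card_le (α : S →* AddMonoid.End A) (c : S)
    (hc : Function.Injective fun x => c * x) (E : Finset S) (X : Finset A) :
    (trajectoryFinset α (E.image fun x => c * x) X).card ≤ (trajectoryFinset α E X).card := by
  have : trajectoryFinset α (E.image fun x => c * x) X = (trajectoryFinset α E X).image (α c) := by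
    rw [trajectoryFinset, trajectoryFinset, Finset.sum_image hc.injOn]
    induction E using Finset.induction_on with
    | empty =>
      rw [Finset.sum_empty, Finset.sum_empty, Finset.image_zero, map_zero]
      rfl
    | insert s E hs ih =>
      rw [Finset.sum_insert hs, Finset.sum_insert hs, Finset.image_add, ih, Finset.image_image]
      congr 2
      ext x
      simp [map_mul]
  rw [this]
  exact Finset.card_image_le

theorem card_sum_le_prod_card {ι : Type*} [DecidableEq A] (s : Finset ι) (f : ι → Finset A) :
    (∑ i ∈ s, f i).card ≤ ∏ i ∈ s, (f i).card := by
  classical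
  induction s using Finset.induction_on with
  | empty => simp
  | insert a s ha ih =>
    rw [Finset.sum_insert ha, Finset.prod_insert ha]
    exact Finset.card_add_le.trans (by gcongr)

theorem averageGrowth_nonneg (α : S →* AddMonoid.End A) (F : Finset S) (X : Finset A) :
    0 ≤ averageGrowth α X F := by
  rw [averageGrowth_eq]
  exact div_nonneg (Real.log_natCast_nonneg _) (Nat.cast_nonneg _)

end Trajectories

/-! ### Growth along Følner nets is bounded by growth on tiles -/

section TileBound

variable {G : Type u} [Group G] {A : Type v} [AddCommGroup A]

-- The fibres of `κ` partition `F`, and the fibre over `c` lies in `c E`; monotonicity completes it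
-- to the full translate.
open Classical in
theorem trajectoryFinset_card_le_pow (α : G →* AddMonoid.End A) {E : Finset G} {κ : G → G}
    (hκ : ∀ g, (κ g)⁻¹ * g ∈ E) (F : Finset G) {X : Finset A} (hX : X.Nonempty) :
    (trajectoryFinset α F X).card ≤ (trajectoryFinset α E X).card ^ (F.image κ).card := by
  have h : trajectoryFinset α F X =
      ∑ c ∈ F.image κ, trajectoryFinset α (F.filter fun g => κ g = c) X :=
    (Finset.sum_fiberwise_of_maps_to (fun g hg => Finset.mem_image_of_mem κ hg) _).symm
  rw [h]
  refine (card_sum_le_prod_card _ _).trans (Finset.prod_le_pow_card _ _ _ fun c _ => ?_)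
  refine (trajectoryFinset_card_mono α (F' := E.image fun x => c * x) ?_ hX).trans
    (trajectoryFinset_image_mul_card_le α c (mul_right_injective c) E X)
  intro g hg
  obtain ⟨-, rfl⟩ := Finset.mem_filter.1 hg
  exact Finset.mem_image.2 ⟨_, hκ g, by simp⟩

-- With `m` translates meeting `F`, `log |T_F| ≤ m log |T_E|`, while `m |E|` exceeds `|F|` by at
-- most the boundary terms. Along a Følner net the factor in parentheses tends to `1`.
open Classical in
theorem IsTile.averageGrowth_le {E : Finset G} (hE : IsTile E) (α : G →* AddMonoid.End A)
    {F : Finset G} (hF : F.Nonempty) {X : Finset A} (hX : X.Nonempty) :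
    averageGrowth α X F ≤ (1 + ∑ p ∈ E ×ˢ E,
      (((F.image fun x => x * (p.1⁻¹ * p.2)) \ F).card : ℝ) / F.card) * averageGrowth α X E := by
  obtain ⟨κ, hκ, hcard⟩ := hE.exists_cover F
  have hF0 : (0 : ℝ) < F.card := by exact_mod_cast hF.card_pos
  have hE0 : (0 : ℝ) < E.card := by exact_mod_cast hE.nonempty.card_pos
  have hlog : Real.log (trajectoryFinset α F X).card ≤
      (F.image κ).card * Real.log (trajectoryFinset α E X).card := by
    rw [← Real.log_pow]
    apply Real.log_le_log
    · exact_mod_cast (trajectoryFinset_nonempty α F hX).card_pos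
    · exact_mod_cast trajectoryFinset_card_le_pow α hκ F hX
  have hcard' : ((F.image κ).card : ℝ) * E.card ≤
      F.card + ∑ p ∈ E ×ˢ E, (((F.image fun x => x * (p.1⁻¹ * p.2)) \ F).card : ℝ) := by
    have := Nat.cast_le (α := ℝ).2 hcard
    push_cast at this
    exact this
  have hg := averageGrowth_nonneg α E X
  have hlogE : Real.log (trajectoryFinset α E X).card = E.card * averageGrowth α X E := by
    rw [averageGrowth_eq]; field_simp
  rw [averageGrowth_eq α F, div_le_iff₀ hF0, ← Finset.sum_div]
  refine hlog.trans ?_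
  rw [hlogE, ← mul_assoc]
  refine (mul_le_mul_of_nonneg_right hcard' hg).trans (le_of_eq ?_)
  rw [mul_right_comm, add_mul 1, one_mul, div_mul_cancel₀ _ hF0.ne']

/-- If the average growth along tiles of `G` is arbitrarily small, it tends to zero along every
right Følner net. -/
theorem isEntropyLimit_zero (α : G →* AddMonoid.End A) {X : Finset A} (hX : X.Nonempty)
    (h : ∀ ε > 0, ∃ E : Finset G, IsTile E ∧ averageGrowth α X E ≤ ε) :
    IsEntropyLimit.{u, v, w} α X 0 := by
  classical
  intro I _ _ _ F hF
  rw [Metric.tendsto_nhds]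
  intro ε hε
  obtain ⟨E, hE, hEε⟩ := h (ε / 2) (by positivity)
  have hlim : Tendsto (fun i => (1 + ∑ p ∈ E ×ˢ E,
      ((((F i).image fun x => x * (p.1⁻¹ * p.2)) \ F i).card : ℝ) / (F i).card) *
        averageGrowth α X E) atTop (𝓝 ((1 + ∑ _p ∈ E ×ˢ E, 0) * averageGrowth α X E)) := by
    refine (tendsto_const_nhds.add (tendsto_finsetSum _ fun p _ => ?_)).mul_const _
    convert hF.2 (p.1⁻¹ * p.2) using 3 with i
    rw [← Set.ncard_coe_finset]
    simp
  simp only [Finset.sum_const_zero, add_zero, one_mul] at hlim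
  filter_upwards [hlim.eventually_lt_const (show averageGrowth α X E < ε by linarith)] with i hi
  rw [Real.dist_eq, sub_zero, abs_of_nonneg (averageGrowth_nonneg _ _ _)]
  exact (hE.averageGrowth_le α (hF.1 i) hX).trans_lt hi

end TileBound

/-! ### The Følner condition, solvable groups, and invariant means -/

section Folner

variable (G : Type u) [Group G]

open Classical in
/-- The right Følner condition of a group. -/
def FolnerCondition : Prop :=
  ∀ (T : Finset G) (ε : ℝ), 0 < ε → ∃ F : Finset G, F.Nonempty ∧
    ∀ s ∈ T, ((F.filter fun x => x * s ∉ F).card : ℝ) ≤ ε * F.card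

variable {G}

theorem FolnerCondition.of_mulEquiv {H : Type v} [Group H] (e : H ≃* G) (hH : FolnerCondition H) :
    FolnerCondition G := by
  classical
  intro T ε hε
  obtain ⟨F, hF, hFT⟩ := hH (T.image e.symm) ε hε
  refine ⟨F.image e, hF.image _, fun s hs => ?_⟩
  rw [Finset.card_image_of_injective _ e.injective]
  refine le_trans (le_of_eq ?_) (hFT _ (Finset.mem_image_of_mem _ hs))
  rw [Finset.filter_image, Finset.card_image_of_injective _ e.injective]
  congr 2
  ext x
  have : e x * s = e (x * e.symm s) := by simp
  simp only [Finset.mem_filter, this, e.injective.mem_finset_image]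

theorem folnerCondition_of_subsingleton [Subsingleton G] : FolnerCondition G := by
  classical
  intro T ε hε
  refine ⟨{1}, Finset.singleton_nonempty _, fun s _ => ?_⟩
  have h (x : G) : x * s ∈ ({1} : Finset G) := Finset.mem_singleton.2 (Subsingleton.elim _ _)
  simp only [h, not_true_eq_false, Finset.filter_false, Finset.card_empty, Nat.cast_zero]
  positivity

/-- Commutative groups satisfy the Følner condition, since their balls grow polynomially. -/
theorem folnerCondition_of_comm {G : Type u} [CommGroup G] : FolnerCondition G := by
  classical
  intro T ε hε
  -- Products of elements of `T` with exponents at most `m`: one more factor from `T` lands in `B (m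
  -- + 1)`.
  let B : ℕ → Finset G := fun m =>
    (Fintype.piFinset fun _ : T => Finset.range (m + 1)).image fun f => ∏ s : T, (s : G) ^ f s
  have hmono : ∀ m, B m ⊆ B (m + 1) := fun m => by
    refine Finset.image_subset_image (Fintype.piFinset_subset _ _ fun _ => ?_)
    exact Finset.range_mono (by omega)
  have hne : ∀ m, (B m).Nonempty := fun m =>
    ⟨1, Finset.mem_image.2 ⟨0, by simp, by simp⟩⟩
  have hmul : ∀ m, ∀ s ∈ T, ∀ x ∈ B m, x * s ∈ B (m + 1) := by
    intro m s hs x hx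
    obtain ⟨f, hf, rfl⟩ := Finset.mem_image.1 hx
    refine Finset.mem_image.2 ⟨f + Pi.single ⟨s, hs⟩ 1, ?_, ?_⟩
    · simp only [Fintype.mem_piFinset, Finset.mem_range, Pi.add_apply] at hf ⊢
      intro t
      have := hf t
      have h1 : (Pi.single (⟨s, hs⟩ : T) 1 : T → ℕ) t ≤ 1 := by
        rw [Pi.single_apply]; split_ifs <;> simp
      omega
    · simp only [Pi.add_apply, pow_add, Finset.prod_mul_distrib]
      congr 1
      rw [Finset.prod_eq_single (⟨s, hs⟩ : T)]
      · simp
      · intro b _ hb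
        simp [hb]
      · simp
  have hcard : ∀ m, (B m).card ≤ (m + 1) ^ T.card := fun m => by
    refine Finset.card_image_le.trans ?_
    simp [Fintype.card_piFinset]
  obtain ⟨m, hm⟩ : ∃ m, ((B (m + 1)).card : ℝ) ≤ (1 + ε) * (B m).card := by
    -- Otherwise `|B m|` would grow at least like `(1 + ε) ^ m`, against the polynomial bound
    -- `hcard`.
    by_contra! hcon
    have hexp : ∀ m, (1 + ε) ^ m ≤ ((B m).card : ℝ) := by
      intro m
      induction m with
      | zero =>
        rw [pow_zero]
        exact_mod_cast (hne 0).card_pos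
      | succ m ih =>
        rw [pow_succ']
        exact (mul_le_mul_of_nonneg_left ih (by positivity)).trans (hcon m).le
    have hlim := tendsto_pow_const_div_const_pow_of_one_lt T.card (show 1 < 1 + ε by linarith)
    have h1 := (hlim.comp (tendsto_add_atTop_nat 1)).eventually_lt_const
      (show (0 : ℝ) < 1 / (1 + ε) by positivity)
    obtain ⟨m, hm⟩ := h1.exists
    have h2 := (hexp m).trans (by exact_mod_cast hcard m : ((B m).card : ℝ) ≤ (m + 1 : ℝ) ^ T.card)
    simp only [Function.comp_apply] at hm
    rw [div_lt_div_iff₀ (by positivity) (by positivity), pow_succ, one_mul] at hm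
    push_cast at hm
    have := lt_of_mul_lt_mul_right hm (by positivity : (0 : ℝ) ≤ 1 + ε)
    linarith
  refine ⟨B m, hne m, fun s hs => ?_⟩
  have h1 : ((B m).filter fun x => x * s ∉ B m).card + (B m).card ≤ (B (m + 1)).card := by
    rw [← Finset.card_image_of_injective _ (mul_left_injective s), ← Finset.card_union_of_disjoint]
    · refine Finset.card_le_card (Finset.union_subset ?_ (hmono m))
      intro y hy
      obtain ⟨x, hx, rfl⟩ := Finset.mem_image.1 hy
      exact hmul m s hs x (Finset.mem_filter.1 hx).1
    · rw [Finset.disjoint_left]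
      intro y hy
      obtain ⟨x, hx, rfl⟩ := Finset.mem_image.1 hy
      exact (Finset.mem_filter.1 hx).2
  have h2 : (((B m).filter fun x => x * s ∉ B m).card : ℝ) + (B m).card ≤ (B (m + 1)).card := by
    exact_mod_cast h1
  linarith

/-- The Følner condition is inherited by group extensions. -/
theorem FolnerCondition.of_extension {Q : Type v} [Group Q] (π : G →* Q)
    (hπ : Function.Surjective π) (hker : FolnerCondition π.ker) (hQ : FolnerCondition Q) :
    FolnerCondition G := by
  classical
  intro T ε hε
  obtain ⟨P, hP, hPT⟩ := hQ (T.image π) (ε / 2) (by positivity)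
  choose σ hσ using hπ
  -- The defect of the section `σ`: `σ q * s = k q s * σ (q * π s)`. Only the finitely many values
  -- on `P ×ˢ T` matter, so `N` is chosen after `P`.
  let k : Q → G → π.ker := fun q s =>
    ⟨σ q * s * (σ (q * π s))⁻¹, by simp [MonoidHom.mem_ker, hσ]⟩
  obtain ⟨N, hN, hNT⟩ := hker ((P ×ˢ T).image fun p => k p.1 p.2) (ε / 2) (by positivity)
  let m : π.ker × Q → G := fun p => p.1 * σ p.2
  have hm : Function.Injective m := by
    rintro ⟨a, q⟩ ⟨b, r⟩ h
    have h' : (a : G) * σ q = b * σ r := h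
    have hq : q = r := by
      have := congrArg π h'
      rwa [map_mul, map_mul, hσ, hσ, a.2, b.2, one_mul, one_mul] at this
    subst hq
    exact Prod.ext (Subtype.ext (mul_right_cancel h')) rfl
  have hmul : ∀ a q s, m (a, q) * s = m (a * k q s, q * π s) := by
    intro a q s
    simp only [m, k, Subgroup.coe_mul]
    group
  refine ⟨(N ×ˢ P).image m, (hN.product hP).image _, fun s hs => ?_⟩
  rw [Finset.card_image_of_injective _ hm, Finset.filter_image,
    Finset.card_image_of_injective _ hm, Finset.card_product]
  have hsub : ((N ×ˢ P).filter fun p => m p * s ∉ (N ×ˢ P).image m) ⊆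
      (N ×ˢ P.filter fun q => q * π s ∉ P) ∪
        P.biUnion fun q => (N.filter fun a => a * k q s ∉ N) ×ˢ {q} := by
    rintro ⟨a, q⟩ h
    rw [Finset.mem_filter, hmul, hm.mem_finset_image, Finset.mem_product, Finset.mem_product] at h
    obtain ⟨⟨ha, hq⟩, h⟩ := h
    rw [Finset.mem_union]
    by_cases hqs : q * π s ∈ P
    · right
      refine Finset.mem_biUnion.2 ⟨q, hq, Finset.mk_mem_product ?_ (Finset.mem_singleton_self q)⟩
      exact Finset.mem_filter.2 ⟨ha, fun hk => h ⟨hk, hqs⟩⟩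
    · exact Or.inl (Finset.mk_mem_product ha (Finset.mem_filter.2 ⟨hq, hqs⟩))
  have h1 : (((N ×ˢ P).filter fun p => m p * s ∉ (N ×ˢ P).image m).card : ℝ) ≤
      N.card * (P.filter fun q => q * π s ∉ P).card +
        ∑ q ∈ P, ((N.filter fun a => a * k q s ∉ N).card : ℝ) := by
    have := (Finset.card_le_card hsub).trans ((Finset.card_union_le _ _).trans
      (Nat.add_le_add_left Finset.card_biUnion_le _))
    simp only [Finset.card_product, Finset.card_singleton, mul_one] at this
    have := Nat.cast_le (α := ℝ).2 this
    push_cast at this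
    exact this
  have h2 := hPT (π s) (Finset.mem_image_of_mem _ hs)
  have h3 : ∑ q ∈ P, ((N.filter fun a => a * k q s ∉ N).card : ℝ) ≤
      ∑ _q ∈ P, ε / 2 * N.card := Finset.sum_le_sum fun q hq => by
    refine le_trans (le_of_eq ?_)
      (hNT (k q s) (Finset.mem_image.2 ⟨(q, s), Finset.mk_mem_product hq hs, rfl⟩))
    congr!
  rw [Finset.sum_const, nsmul_eq_mul] at h3
  have h4 := mul_le_mul_of_nonneg_left h2 (Nat.cast_nonneg (α := ℝ) N.card)
  push_cast
  linarith

/-- Climbing the derived series from the trivial end, each term extends an abelian group, its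
abelianization, by the next term. -/
theorem folnerCondition_of_isSolvable [hG : Group.IsSolvable G] : FolnerCondition G := by
  obtain ⟨n, hn⟩ := hG.solvable
  suffices h : ∀ j ≤ n, FolnerCondition (derivedSeries G (n - j)) by
    have h0 := h n le_rfl
    rw [Nat.sub_self, derivedSeries_zero] at h0
    exact h0.of_mulEquiv Subgroup.topEquiv
  intro j
  induction j with
  | zero =>
    intro _
    rw [Nat.sub_zero, hn]
    exact folnerCondition_of_subsingleton
  | succ j ih =>
    intro hj
    have hD := ih (by omega)
    obtain ⟨i, hi⟩ : ∃ i, n - j = i + 1 ∧ n - (j + 1) = i := ⟨n - (j + 1), by omega, rfl⟩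
    rw [hi.1, derivedSeries_succ, ← Subgroup.map_subtype_commutator] at hD
    rw [hi.2]
    have hc : FolnerCondition (commutator (derivedSeries G i)) :=
      hD.of_mulEquiv (Subgroup.equivMapOfInjective _ _ (Subgroup.subtype_injective _)).symm
    refine FolnerCondition.of_extension Abelianization.of Quot.mk_surjective ?_
      folnerCondition_of_comm
    rwa [Abelianization.ker_of]

/-- The Følner condition gives a right Følner net, indexed by finite sets and tolerances. -/
theorem FolnerCondition.exists_net (h : FolnerCondition G) :
    ∃ (I : Type u) (_ : Preorder I) (_ : IsDirectedOrder I) (_ : Nonempty I) (F : I → Finset G),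
      IsRightFolnerNet F := by
  classical
  choose F hne hF using fun i : Finset G × ℕ => h i.1 (1 / (i.2 + 1)) (by positivity)
  refine ⟨Finset G × ℕ, inferInstance, inferInstance, inferInstance, F, hne, fun s => ?_⟩
  have hlim : Tendsto (fun i : Finset G × ℕ => 1 / ((i.2 : ℝ) + 1)) atTop (𝓝 0) := by
    rw [← prod_atTop_atTop_eq]
    exact tendsto_one_div_add_atTop_nhds_zero_nat.comp tendsto_snd
  refine squeeze_zero' (Eventually.of_forall fun i => by positivity) ?_ hlim
  filter_upwards [eventually_ge_atTop (({s}, 0) : Finset G × ℕ)] with i hi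
  have hF0 : (0 : ℝ) < (F i).card := by exact_mod_cast (hne i).card_pos
  rw [div_le_iff₀ hF0]
  refine le_trans (le_of_eq ?_) (hF i s (hi.1 (Finset.mem_singleton_self s)))
  rw [← Finset.card_image_of_injective _ (mul_left_injective s), ← Set.ncard_coe_finset]
  congr 2
  ext y
  simp only [Set.mem_sdiff, Set.mem_image, Finset.mem_coe, Finset.mem_image, Finset.mem_filter]
  constructor
  · rintro ⟨⟨x, hx, rfl⟩, hy⟩
    exact ⟨x, ⟨hx, hy⟩, rfl⟩
  · rintro ⟨x, ⟨hx, hy⟩, rfl⟩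
    exact ⟨⟨x, hx, rfl⟩, hy⟩

open Classical in
/-- The mean of a group along an ultrafilter finer than the tails of a right Følner net. -/
theorem IsRightFolnerNet.isRightAmenable {I : Type w} [Preorder I] [IsDirectedOrder I] [Nonempty I]
    {F : I → Finset G} (hF : IsRightFolnerNet F) : IsRightAmenable G := by
  let U : Ultrafilter I := Ultrafilter.of atTop
  have hU : (U : Filter I) ≤ atTop := Ultrafilter.of_le _
  let d : Set G → I → ℝ := fun E i => ((F i).filter fun x => x ∈ E).card / (F i).card
  have hF0 : ∀ i, (0 : ℝ) < (F i).card := fun i => by exact_mod_cast (hF.1 i).card_pos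
  have hd : ∀ E i, d E i ∈ Set.Icc (0 : ℝ) 1 := fun E i =>
    ⟨by positivity, by
      rw [div_le_one (hF0 i)]
      exact_mod_cast Finset.card_filter_le _ _⟩
  have hex : ∀ E, ∃ l ∈ Set.Icc (0 : ℝ) 1, Tendsto (d E) U (𝓝 l) := fun E =>
    isCompact_Icc.ultrafilter_le_nhds (U.map (d E))
      (le_principal_iff.2 (Filter.mem_map.2 (Eventually.of_forall (hd E))))
  choose μ hμ hlim using hex
  refine ⟨μ, fun E => hμ E, ?_, fun E E' hdisj => ?_, fun s E => ?_⟩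
  · refine tendsto_nhds_unique (hlim Set.univ) (tendsto_const_nhds.congr fun i => ?_)
    simp [d, (hF0 i).ne']
  · refine tendsto_nhds_unique (hlim (E ∪ E')) (((hlim E).add (hlim E')).congr fun i => ?_)
    simp only [d]
    rw [← add_div, ← Nat.cast_add, ← Finset.card_union_of_disjoint, ← Finset.filter_or]
    · simp only [Set.mem_union]
    · exact Finset.disjoint_filter.2 fun x _ hx hx' => Set.disjoint_left.1 hdisj hx hx'
  · have key : ∀ i, |d ((fun x => x * s) ⁻¹' E) i - d E i| ≤
        (((fun x => x * s) '' (F i : Set G) \ (F i : Set G)).ncard : ℝ) / ((F i).card : ℝ) := by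
      intro i
      let P := (F i).image fun x => x * s
      have hP : P.card = (F i).card := Finset.card_image_of_injective _ (mul_left_injective s)
      have h1 : ((F i).filter fun x => x ∈ (fun x => x * s) ⁻¹' E).card =
          (P.filter fun x => x ∈ E).card := by
        rw [Finset.filter_image, Finset.card_image_of_injective _ (mul_left_injective s)]
        rfl
      have h2 : ((fun x => x * s) '' (F i : Set G) \ (F i : Set G)).ncard = (P \ F i).card := by
        rw [← Set.ncard_coe_finset]
        simp [P]
      have h3 : ∀ A B : Finset G, (A.filter fun x => x ∈ E).card ≤
          (B.filter fun x => x ∈ E).card + (A \ B).card := fun A B => by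
        refine (Finset.card_le_card fun x hx => ?_).trans (Finset.card_union_le _ _)
        rw [Finset.mem_filter] at hx
        by_cases hB : x ∈ B <;> simp [hx, hB]
      have h4 := Nat.cast_le (α := ℝ).2 (h3 P (F i))
      have h5 := Nat.cast_le (α := ℝ).2 (h3 (F i) P)
      -- `F i` and its translate have equal size, so both one-sided differences have the size
      -- controlled by the Følner condition.
      rw [Finset.card_sdiff_comm hP.symm] at h5
      push_cast at h4 h5
      simp only [d]
      rw [h1, h2, ← sub_div, abs_div, abs_of_pos (hF0 i)]
      gcongr
      rw [abs_le]
      constructor <;> linarith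
    have h0 : Tendsto (fun i => d ((fun x => x * s) ⁻¹' E) i - d E i) U (𝓝 0) :=
      squeeze_zero_norm key ((hF.2 s).mono_left hU)
    have h1 := tendsto_nhds_unique h0 ((hlim _).sub (hlim E))
    linarith

end Folner

/-! ### Finite groups, products, and boxes as tiles -/

section TileExamples

theorem isTile_univ (G : Type u) [Group G] [Fintype G] : IsTile (Finset.univ : Finset G) :=
  ⟨{1}, fun _ => ⟨1, by simp, fun _ h => h.1⟩⟩

theorem IsTile.prod {G : Type u} {H : Type v} [Group G] [Group H] {E : Finset G} {E' : Finset H}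
    (hE : IsTile E) (hE' : IsTile E') : IsTile (E ×ˢ E') := by
  obtain ⟨C, hC⟩ := hE
  obtain ⟨C', hC'⟩ := hE'
  refine ⟨C ×ˢ C', fun g => ?_⟩
  obtain ⟨c, hc, huniq⟩ := hC g.1
  obtain ⟨c', hc', huniq'⟩ := hC' g.2
  refine ⟨(c, c'), ⟨⟨hc.1, hc'.1⟩, Finset.mk_mem_product hc.2 hc'.2⟩, ?_⟩
  rintro ⟨d, d'⟩ ⟨⟨hd, hd'⟩, hmem⟩
  have hmem' := Finset.mem_product.1 hmem
  exact Prod.ext (huniq d ⟨hd, hmem'.1⟩) (huniq' d' ⟨hd', hmem'.2⟩)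

/-- An interval is a tile of the infinite cyclic group. -/
theorem isTile_image_range {N : ℕ} (hN : 0 < N) :
    IsTile ((Finset.range N).image fun i : ℕ => Multiplicative.ofAdd (i : ℤ)) := by
  have hmem : ∀ z : Multiplicative ℤ,
      z ∈ (Finset.range N).image (fun i : ℕ => Multiplicative.ofAdd (i : ℤ)) ↔
        0 ≤ z.toAdd ∧ z.toAdd < N := by
    intro z
    rw [Finset.mem_image]
    constructor
    · rintro ⟨i, hi, rfl⟩
      simpa using hi
    · rintro ⟨h0, h1⟩
      refine ⟨z.toAdd.toNat, by rw [Finset.mem_range]; omega, ?_⟩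
      rw [Int.toNat_of_nonneg h0]
      rfl
  have hN' : (0 : ℤ) < N := by exact_mod_cast hN
  refine ⟨{c | (N : ℤ) ∣ c.toAdd}, fun g => ?_⟩
  refine ⟨Multiplicative.ofAdd (N * (g.toAdd / N)), ⟨Dvd.intro _ rfl, (hmem _).2 ?_⟩, ?_⟩
  · have h1 := Int.emod_nonneg g.toAdd hN'.ne'
    have h2 := Int.emod_lt_of_pos g.toAdd hN'
    have h3 := Int.emod_add_mul_ediv g.toAdd N
    simp only [toAdd_mul, toAdd_inv, toAdd_ofAdd]
    constructor <;> linarith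
  · rintro c ⟨⟨k, hk⟩, hc⟩
    obtain ⟨h0, h1⟩ := (hmem _).1 hc
    simp only [toAdd_mul, toAdd_inv, hk] at h0 h1
    apply Multiplicative.toAdd.injective
    rw [hk, toAdd_ofAdd]
    congr 1
    refine ((Int.ediv_eq_iff_of_pos hN').2 ⟨?_, ?_⟩).symm <;> linarith

/-- Boxes spanned by two multiplicatively independent elements of a commutative group are tiles. -/
theorem exists_box_tile {M : Type u} [CommGroup M] {a b : M}
    (h : ∀ i j i' j' : ℕ, a ^ i * b ^ j = a ^ i' * b ^ j' → i = i' ∧ j = j') {N : ℕ} (hN : 0 < N) :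
    ∃ E : Finset M, IsTile E ∧ E.card = N * N ∧ ∀ E' ⊆ E, ∃ P ⊆ Finset.range N ×ˢ Finset.range N,
      ∀ (A : Type v) [AddCommMonoid A] (f : M → A), ∑ e ∈ E', f e = ∑ p ∈ P, f (a ^ p.1 * b ^ p.2) := by
  classical
  let φ : Multiplicative ℤ × Multiplicative ℤ →* M :=
    (zpowersHom M a).coprod (zpowersHom M b)
  have hφ : Function.Injective φ := by
    rw [injective_iff_map_eq_one]
    rintro ⟨x, y⟩ hxy
    have hxy' : a ^ x.toAdd * b ^ y.toAdd = 1 := by simpa [φ] using hxy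
    -- Integer exponents are split into positive and negative parts and moved to opposite sides,
    -- where `h` on natural exponents applies.
    have hx := Int.toNat_sub_toNat_neg x.toAdd
    have hy := Int.toNat_sub_toNat_neg y.toAdd
    rw [← hx, ← hy, zpow_sub, zpow_sub, zpow_natCast, zpow_natCast, zpow_natCast, zpow_natCast,
      ← div_eq_mul_inv, ← div_eq_mul_inv, div_mul_div_comm, div_eq_one] at hxy'
    obtain ⟨h1, h2⟩ := h _ _ _ _ hxy'
    refine Prod.ext (Multiplicative.toAdd.injective ?_) (Multiplicative.toAdd.injective ?_)
    · simp only [Prod.fst_one, toAdd_one]; omega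
    · simp only [Prod.snd_one, toAdd_one]; omega
  have hinj : Function.Injective fun p : ℕ × ℕ => a ^ p.1 * b ^ p.2 := fun p q hpq =>
    Prod.ext (h _ _ _ _ hpq).1 (h _ _ _ _ hpq).2
  refine ⟨(Finset.range N ×ˢ Finset.range N).image fun p => a ^ p.1 * b ^ p.2, ?_, ?_, ?_⟩
  · convert ((isTile_image_range hN).prod (isTile_image_range hN)).map φ hφ using 1
    ext z
    simp only [Finset.mem_image, Finset.mem_map, Finset.mem_product, Prod.exists]
    constructor
    · rintro ⟨i, j, ⟨hi, hj⟩, rfl⟩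
      exact ⟨_, _, ⟨⟨i, hi, rfl⟩, ⟨j, hj, rfl⟩⟩, by simp [φ]⟩
    · rintro ⟨_, _, ⟨⟨i, hi, rfl⟩, ⟨j, hj, rfl⟩⟩, rfl⟩
      exact ⟨i, j, ⟨hi, hj⟩, by simp [φ]⟩
  · rw [Finset.card_image_of_injective _ hinj]
    simp
  · intro E' hE'
    obtain ⟨P, hP, rfl⟩ := Finset.subset_image_iff.1 hE'
    exact ⟨P, by exact_mod_cast hP, fun A _ f => Finset.sum_image hinj.injOn⟩

end TileExamples

/-! ### Tiles of the multiplicative group with few subset sums -/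

section FewSums

variable {K : Type u} [Field K]

/-- The multiplicative group of `K` has tiles all of whose subset sums lie in a set of cardinality
subexponential in the cardinality of the tile. -/
def HasTilesWithFewSums (K : Type u) [Field K] : Prop :=
  ∀ ε : ℝ, 0 < ε → ∃ E : Finset Kˣ, IsTile E ∧ ∃ R : Finset K,
    (∀ E' ⊆ E, ∑ e ∈ E', (e : K) ∈ R) ∧ Real.log R.card ≤ ε * E.card

/-- A box of side `N` has `N ^ 2` elements, whereas `log |R|` is only linear in `N`. -/
theorem hasTilesWithFewSums_of_independent {a b : Kˣ}
    (h : ∀ i j i' j' : ℕ, a ^ i * b ^ j = a ^ i' * b ^ j' → i = i' ∧ j = j') {B : ℕ}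
    (hR : ∀ N : ℕ, ∃ R : Finset K, R.card ≤ B ^ N ∧
      ∀ P ⊆ Finset.range N ×ˢ Finset.range N, ∑ p ∈ P, (a : K) ^ p.1 * (b : K) ^ p.2 ∈ R) :
    HasTilesWithFewSums K := by
  intro ε hε
  obtain ⟨N, hN⟩ := exists_nat_gt (Real.log B / ε)
  have hlogB : 0 ≤ Real.log B := Real.log_natCast_nonneg _
  have hN0 : 0 < N := by
    have : (0 : ℝ) < N := lt_of_le_of_lt (by positivity) hN
    exact_mod_cast this
  obtain ⟨E, hE, hcard, hsum⟩ := exists_box_tile h hN0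
  obtain ⟨R, hRcard, hRmem⟩ := hR N
  refine ⟨E, hE, R, fun E' hE' => ?_, ?_⟩
  · obtain ⟨P, hP, hPs⟩ := hsum E' hE'
    rw [hPs K fun e => (e : K)]
    simpa using hRmem P hP
  · have hR0 : 0 < R.card := Finset.card_pos.2 ⟨_, hRmem ∅ (Finset.empty_subset _)⟩
    have h1 : Real.log R.card ≤ N * Real.log B := by
      rw [← Real.log_pow]
      exact Real.log_le_log (by exact_mod_cast hR0) (by exact_mod_cast hRcard)
    rw [hcard, Nat.cast_mul]
    rw [div_lt_iff₀ hε] at hN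
    have h2 := mul_le_mul_of_nonneg_left hN.le (Nat.cast_nonneg (α := ℝ) N)
    linarith

/-- Subset sums of the box `2 ^ i * 3 ^ j` are natural numbers below `2 ^ N * 3 ^ N`; independence
is unique factorization. -/
theorem hasTilesWithFewSums_of_charZero [CharZero K] : HasTilesWithFewSums K := by
  classical
  refine hasTilesWithFewSums_of_independent (a := Units.mk0 2 two_ne_zero)
    (b := Units.mk0 3 three_ne_zero) (B := 6) ?_ fun N => ?_
  · intro i j i' j' h
    have h1 := congrArg (fun x : Kˣ => (x : K)) h
    simp only [Units.val_mul, Units.val_pow_eq_pow_val, Units.val_mk0] at h1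
    have h2 : 2 ^ i * 3 ^ j = 2 ^ i' * 3 ^ j' := by exact_mod_cast h1
    have key : ∀ i j : ℕ, (2 ^ i * 3 ^ j).factorization 2 = i ∧
        (2 ^ i * 3 ^ j).factorization 3 = j := by
      intro i j
      rw [Nat.factorization_mul (by positivity) (by positivity), Nat.prime_two.factorization_pow,
        Nat.prime_three.factorization_pow]
      simp
    exact ⟨by rw [← (key i j).1, h2, (key i' j').1], by rw [← (key i j).2, h2, (key i' j').2]⟩
  · refine ⟨(Finset.range (6 ^ N)).image fun i : ℕ => (i : K), ?_, fun P hP => ?_⟩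
    · exact Finset.card_image_le.trans (by simp)
    · refine Finset.mem_image.2 ⟨∑ p ∈ P, 2 ^ p.1 * 3 ^ p.2, ?_, by simp⟩
      rw [Finset.mem_range]
      have h1 : ∑ p ∈ P, 2 ^ p.1 * 3 ^ p.2 ≤
          (∑ i ∈ Finset.range N, 2 ^ i) * ∑ j ∈ Finset.range N, 3 ^ j := by
        rw [Finset.sum_mul_sum, ← Finset.sum_product']
        exact Finset.sum_le_sum_of_subset hP
      have h2 : ∑ i ∈ Finset.range N, 2 ^ i < 2 ^ N :=
        Nat.geomSum_lt le_rfl fun k hk => Finset.mem_range.1 hk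
      have h3 : ∑ i ∈ Finset.range N, 3 ^ i < 3 ^ N :=
        Nat.geomSum_lt (by norm_num) fun k hk => Finset.mem_range.1 hk
      calc _ ≤ _ := h1
        _ < 2 ^ N * 3 ^ N := Nat.mul_lt_mul'' h2 h3
        _ = 6 ^ N := by rw [← mul_pow]; norm_num

-- Subset sums of the box `t ^ i * (t - 1) ^ j` are values at `t` of polynomials of degree less than
-- `2 * N` over the finite field `k`.
open Polynomial in
theorem hasTilesWithFewSums_of_transcendental {k : Type*} [Field k] [Fintype k] [Algebra k K]
    {t : K} (ht : Transcendental k t) : HasTilesWithFewSums K := by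
  classical
  have hinj : Function.Injective (aeval t : k[X] →ₐ[k] K) := transcendental_iff_injective.1 ht
  have h0 : t ≠ 0 := fun h => X_ne_zero (hinj (by simp [h]) : (X : k[X]) = 0)
  have h1 : t - 1 ≠ 0 := fun h =>
    X_sub_C_ne_zero (1 : k) (hinj (by simp [h]) : (X - C 1 : k[X]) = 0)
  refine hasTilesWithFewSums_of_independent (a := Units.mk0 t h0) (b := Units.mk0 (t - 1) h1)
    (B := Fintype.card k ^ 2) ?_ fun N => ?_
  · intro i j i' j' h
    have h2 := congrArg (fun x : Kˣ => (x : K)) h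
    simp only [Units.val_mul, Units.val_pow_eq_pow_val, Units.val_mk0] at h2
    have h3 : (X - C 0 : k[X]) ^ i * (X - C 1) ^ j = (X - C 0) ^ i' * (X - C 1) ^ j' :=
      hinj (by simpa using h2)
    -- The exponents are recovered as the multiplicities of the roots `0` and `1`.
    have key : ∀ i j : ℕ, ((X - C 0 : k[X]) ^ i * (X - C 1) ^ j).roots.count 0 = i ∧
        ((X - C 0 : k[X]) ^ i * (X - C 1) ^ j).roots.count 1 = j := by
      intro i j
      rw [roots_mul (mul_ne_zero (pow_ne_zero _ (X_sub_C_ne_zero _))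
        (pow_ne_zero _ (X_sub_C_ne_zero _))), roots_pow, roots_pow, roots_X_sub_C, roots_X_sub_C]
      simp
    exact ⟨by rw [← (key i j).1, h3, (key i' j').1], by rw [← (key i j).2, h3, (key i' j').2]⟩
  · refine ⟨Finset.univ.image fun c : Fin (2 * N) → k => ∑ i, c i • t ^ (i : ℕ), ?_, fun P hP => ?_⟩
    · exact Finset.card_image_le.trans (by simp [pow_mul])
    · obtain rfl | hP0 := P.eq_empty_or_nonempty
      · exact Finset.mem_image.2 ⟨0, by simp⟩
      let q : k[X] := ∑ p ∈ P, X ^ p.1 * (X - C 1) ^ p.2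
      have hN : 0 < N := by
        obtain ⟨p, hp⟩ := hP0
        have := hP hp
        simp only [Finset.mem_product, Finset.mem_range] at this
        omega
      have hq : q.natDegree < 2 * N := by
        refine lt_of_le_of_lt (natDegree_sum_le_of_forall_le (n := 2 * N - 1) P _ fun p hp => ?_)
          (by omega)
        have := hP hp
        simp only [Finset.mem_product, Finset.mem_range] at this
        refine natDegree_mul_le.trans ?_
        rw [natDegree_pow, natDegree_pow, natDegree_X, natDegree_X_sub_C]
        omega
      refine Finset.mem_image.2 ⟨fun i => q.coeff i, Finset.mem_univ _, ?_⟩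
      rw [Fin.sum_univ_eq_sum_range (fun i => q.coeff i • t ^ i), ← aeval_eq_sum_range' hq]
      simp [q]

/-- Finitely many elements generate a finite subfield `L`, which can be made arbitrarily large.
Subset sums of `Lˣ` stay in `L`, and `log q / (q - 1)` tends to `0`. -/
theorem hasTilesWithFewSums_of_isAlgebraic {k : Type*} [Field k] [Finite k] [Algebra k K]
    [Infinite K] [Algebra.IsAlgebraic k K] : HasTilesWithFewSums K := by
  classical
  intro ε hε
  obtain ⟨x₀, hx₀⟩ := eventually_atTop.1
    ((Real.isLittleO_log_id_atTop.bound (show 0 < ε / 2 by positivity)))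
  -- For `q ≥ x₀`, `log q ≤ ε / 2 * q`; for `q ≥ 2` this is at most `ε * (q - 1)`.
  obtain ⟨N, hN⟩ := exists_nat_ge (max x₀ 2)
  obtain ⟨s, hs⟩ := Infinite.exists_subset_card_eq K N
  let L := IntermediateField.adjoin k (s : Set K)
  have hfd : FiniteDimensional k L := IntermediateField.finiteDimensional_adjoin
    fun x _ => Algebra.IsIntegral.isIntegral x
  have : Finite L := Module.finite_of_finite k
  let _ : Fintype L := Fintype.ofFinite L
  have hinj : Function.Injective (Units.map (algebraMap L K : L →* K)) :=
    Units.map_injective (algebraMap L K).injective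
  refine ⟨_, (isTile_univ Lˣ).map _ hinj, Finset.univ.image (algebraMap L K), ?_, ?_⟩
  · intro E' hE'
    refine Finset.mem_image.2 ⟨⟨∑ e ∈ E', (e : K), sum_mem fun e he => ?_⟩, Finset.mem_univ _, rfl⟩
    obtain ⟨u, -, rfl⟩ := Finset.mem_map.1 (hE' he)
    exact (u : L).2
  · rw [Finset.card_image_of_injective _ (algebraMap L K).injective, Finset.card_map,
      Finset.card_univ, Finset.card_univ, Fintype.card_units]
    have hcard : N ≤ Fintype.card L := by
      rw [← hs, ← Fintype.card_coe]
      exact Fintype.card_le_of_injective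
        (fun x : s => (⟨x, IntermediateField.subset_adjoin k _ x.2⟩ : L))
        fun x y hxy => Subtype.ext (congrArg (fun z : L => (z : K)) hxy)
    have hq : max x₀ 2 ≤ (Fintype.card L : ℝ) := hN.trans (by exact_mod_cast hcard)
    have h2 : (2 : ℝ) ≤ Fintype.card L := (le_max_right _ _).trans hq
    have h1 := (le_abs_self _).trans (hx₀ _ ((le_max_left _ _).trans hq))
    rw [id, Real.norm_of_nonneg (by positivity)] at h1
    rw [Nat.cast_sub Fintype.card_pos, Nat.cast_one]
    have := mul_le_mul_of_nonneg_left h2 hε.le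
    linarith

/-- Every infinite field has tiles with few subset sums. -/
theorem hasTilesWithFewSums [Infinite K] : HasTilesWithFewSums K := by
  obtain ⟨p, hp⟩ := CharP.exists K
  obtain hp' | rfl := CharP.char_is_prime_or_zero K p
  · have : Fact p.Prime := ⟨hp'⟩
    let _ : Algebra (ZMod p) K := ZMod.algebra K p
    by_cases h : Algebra.IsAlgebraic (ZMod p) K
    · exact hasTilesWithFewSums_of_isAlgebraic (k := ZMod p)
    · rw [← Algebra.transcendental_iff_not_isAlgebraic, Algebra.transcendental_def] at h
      obtain ⟨t, ht⟩ := h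
      exact hasTilesWithFewSums_of_transcendental ht
  · have := CharP.charP_to_charZero K
    exact hasTilesWithFewSums_of_charZero

end FewSums

/-! ### Actions of groups containing the scalars -/

section Scalars

variable {K : Type u} [Field K] {G : Type w} [Group G] {V : Type v} [AddCommGroup V] [Module K V]

/-- Collecting the terms `e • x` by `x` leaves one coefficient in `R` for each `x ∈ X`. -/
theorem trajectoryFinset_card_le_of_sums_mem (α : G →* AddMonoid.End V) (ι : Kˣ →* G)
    (hι : Function.Injective ι) (hα : ∀ c v, α (ι c) v = (c : K) • v) {E : Finset Kˣ} {R : Finset K}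
    (hR : ∀ E' ⊆ E, ∑ e ∈ E', (e : K) ∈ R) (X : Finset V) :
    (trajectoryFinset α (E.map ⟨ι, hι⟩) X).card ≤ R.card ^ X.card := by
  classical
  have hsub : trajectoryFinset α (E.map ⟨ι, hι⟩) X ⊆
      (Fintype.piFinset fun _ : X => R).image fun c => ∑ x : X, c x • (x : V) := by
    intro y hy
    rw [trajectoryFinset, Finset.sum_map, ← Finset.mem_coe, Finset.coe_sum,
      Set.mem_finsetSum] at hy
    obtain ⟨f, hf, rfl⟩ := hy
    have hf' : ∀ e : Kˣ, ∃ x : V, e ∈ E → x ∈ X ∧ (e : K) • x = f e := by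
      intro e
      by_cases he : e ∈ E
      · obtain ⟨x, hx, hxe⟩ := Finset.mem_image.1 (hf he)
        exact ⟨x, fun _ => ⟨hx, by rw [← hxe]; exact (hα e x).symm⟩⟩
      · exact ⟨0, fun h => absurd h he⟩
    choose g hg using hf'
    refine Finset.mem_image.2 ⟨fun x => ∑ e ∈ E.filter fun e => g e = x, (e : K), ?_, ?_⟩
    · exact Fintype.mem_piFinset.2 fun x => hR _ (Finset.filter_subset _ _)
    · rw [Finset.sum_coe_sort X fun x => (∑ e ∈ E.filter fun e => g e = x, (e : K)) • x,
        ← Finset.sum_fiberwise_of_maps_to fun e he => (hg e he).1]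
      refine Finset.sum_congr rfl fun x _ => ?_
      rw [Finset.sum_smul]
      refine Finset.sum_congr rfl fun e he => ?_
      obtain ⟨heE, rfl⟩ := Finset.mem_filter.1 he
      exact (hg e heE).2
  refine (Finset.card_le_card hsub).trans (Finset.card_image_le.trans ?_)
  simp [Fintype.card_piFinset]

/-- An action by a group that contains the scalars of an infinite field has vanishing growth along
every right Følner net. -/
theorem isEntropyLimit_zero_of_scalars [Infinite K] (α : G →* AddMonoid.End V) (ι : Kˣ →* G)
    (hι : Function.Injective ι) (hα : ∀ c v, α (ι c) v = (c : K) • v) {X : Finset V}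
    (hX : X.Nonempty) : IsEntropyLimit.{w, v} α X 0 := by
  refine isEntropyLimit_zero α hX fun ε hε => ?_
  have hX0 : (0 : ℝ) < X.card := by exact_mod_cast hX.card_pos
  obtain ⟨E, hE, R, hR, hlog⟩ := hasTilesWithFewSums (K := K) (ε / X.card) (by positivity)
  refine ⟨_, hE.map ι hι, ?_⟩
  have hE0 : (0 : ℝ) < (E.map ⟨ι, hι⟩).card := by exact_mod_cast (hE.map ι hι).nonempty.card_pos
  rw [averageGrowth_eq, div_le_iff₀ hE0, Finset.card_map]
  calc _ ≤ Real.log ((R.card : ℝ) ^ X.card) := by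
        apply Real.log_le_log
        · exact_mod_cast (trajectoryFinset_nonempty α _ hX).card_pos
        · exact_mod_cast trajectoryFinset_card_le_of_sums_mem α ι hι hα hR X
    _ = X.card * Real.log R.card := Real.log_pow _ _
    _ ≤ X.card * (ε / X.card * E.card) := by gcongr
    _ = ε * E.card := by field_simp

end Scalars

/-! ### From vanishing limits to the entropy -/

section Conclusion

variable {G : Type u} [Group G] {A : Type v} [AddCommGroup A]

/-- Uniqueness of the limit requires a Følner net to exist; otherwise every real number would
satisfy the limit predicate vacuously. -/
theorem entropyOn_eq_zero (hG : FolnerCondition G) {α : G →* AddMonoid.End A} {X : Finset A}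
    (h : IsEntropyLimit.{u, v, u} α X 0) : entropyOn α X = 0 := by
  obtain ⟨I, _, _, _, F, hF⟩ := hG.exists_net
  have hspec : IsEntropyLimit.{u, v, u} α X (entropyOn α X) :=
    Classical.epsilon_spec (p := fun L => IsEntropyLimit.{u, v, u} α X L) ⟨0, h⟩
  exact tendsto_nhds_unique (hspec I F hF) (h I F hF)

/-- `h` identifies the chosen value `entropyOn`, which refers to nets in universe `u`; `h'` gives
convergence along nets in universe `w`. -/
theorem entropyDefined_and_algEntropy_eq_zero (hG : FolnerCondition G) {α : G →* AddMonoid.End A}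
    (h : ∀ X : Finset A, X.Nonempty → IsEntropyLimit.{u, v, u} α X 0)
    (h' : ∀ X : Finset A, X.Nonempty → IsEntropyLimit.{u, v, w} α X 0) :
    EntropyDefined.{u, v, w} α ∧ algEntropy α = 0 := by
  refine ⟨⟨?_, hG.exists_net, fun X hX => ?_⟩, ?_⟩
  · obtain ⟨I, _, _, _, F, hF⟩ := hG.exists_net
    exact hF.isRightAmenable
  · rw [entropyOn_eq_zero hG (h X hX)]
    exact h' X hX
  · have : Nonempty {X : Finset A // X.Nonempty} := ⟨⟨{0}, Finset.singleton_nonempty 0⟩⟩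
    have h0 : ∀ X : {X : Finset A // X.Nonempty}, (entropyOn α X.1 : EReal) = 0 := fun X => by
      rw [entropyOn_eq_zero hG (h X.1 X.2), EReal.coe_zero]
    rw [algEntropy, iSup_congr h0, ciSup_const]

end Conclusion

/-! ### Solvability of the upper triangular group -/

section UpperTriangular

open scoped commutatorElement

variable (K : Type u) [Field K] (n : ℕ)

/-- The matrices `M` with `M i j = 0` for `j < i + k`. -/
def IsUpperBand {K : Type u} [Field K] {n : ℕ} (k : ℕ) (M : Matrix (Fin n) (Fin n) K) : Prop :=
  ∀ i j : Fin n, (j : ℕ) < i + k → M i j = 0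

variable {K n}

theorem IsUpperBand.mul {k l : ℕ} {M N : Matrix (Fin n) (Fin n) K} (hM : IsUpperBand k M)
    (hN : IsUpperBand l N) : IsUpperBand (k + l) (M * N) := by
  intro i j hij
  rw [Matrix.mul_apply]
  refine Finset.sum_eq_zero fun m _ => ?_
  by_cases h : (m : ℕ) < i + k
  · rw [hM i m h, zero_mul]
  · rw [hN m j (by omega), mul_zero]

theorem IsUpperBand.sub {k : ℕ} {M N : Matrix (Fin n) (Fin n) K} (hM : IsUpperBand k M)
    (hN : IsUpperBand k N) : IsUpperBand k (M - N) := fun i j h => by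
  rw [Matrix.sub_apply, hM i j h, hN i j h, sub_zero]

theorem IsUpperBand.add {k : ℕ} {M N : Matrix (Fin n) (Fin n) K} (hM : IsUpperBand k M)
    (hN : IsUpperBand k N) : IsUpperBand k (M + N) := fun i j h => by
  rw [Matrix.add_apply, hM i j h, hN i j h, add_zero]

theorem IsUpperBand.mono {k l : ℕ} (h : k ≤ l) {M : Matrix (Fin n) (Fin n) K}
    (hM : IsUpperBand l M) : IsUpperBand k M := fun i j hij => hM i j (by omega)

theorem IsUpperBand.mul_sub_mul {k : ℕ} {M N : Matrix (Fin n) (Fin n) K} (hM : IsUpperBand k M)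
    (hN : IsUpperBand k N) : IsUpperBand (k + 1) (M * N - N * M) := by
  -- For `k = 0` the gain comes from the cancelling diagonals of `M * N` and `N * M`; for `k ≥ 1`,
  -- from `k + k ≥ k + 1`.
  obtain rfl | hk := k.eq_zero_or_pos
  · have hdiag : ∀ {M N : Matrix (Fin n) (Fin n) K}, IsUpperBand 0 M → IsUpperBand 0 N →
        ∀ i, (M * N) i i = M i i * N i i := by
      intro M N hM hN i
      rw [Matrix.mul_apply, Finset.sum_eq_single i]
      · intro m _ hm
        obtain h | h := lt_or_gt_of_ne hm
        · rw [hM i m (by simpa using h), zero_mul]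
        · rw [hN m i (by simpa using h), mul_zero]
      · simp
    intro i j hij
    obtain h | h := (Nat.lt_succ_iff.1 (by omega : (j : ℕ) < i + 1)).lt_or_eq
    · exact (hM.mul hN).sub (hN.mul hM) i j (by omega)
    · obtain rfl : j = i := Fin.ext h
      rw [Matrix.sub_apply, hdiag hM hN, hdiag hN hM, mul_comm, sub_self]
  · exact ((hM.mul hN).sub (hN.mul hM)).mono (by omega)

theorem isUpperBand_zero (g : upperTriangular K n) :
    IsUpperBand 0 (g.1 : Matrix (Fin n) (Fin n) K) := fun i j h => g.2 i j (by simpa using h)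

theorem isUpperBand_derivedSeries (k : ℕ) (g : upperTriangular K n)
    (hg : g ∈ derivedSeries (upperTriangular K n) k) :
    IsUpperBand k ((g.1 : Matrix (Fin n) (Fin n) K) - 1) := by
  induction k generalizing g with
  | zero => exact (isUpperBand_zero g).sub (isUpperBand_zero 1)
  | succ k ih =>
    have hcomm : ∀ a ∈ derivedSeries (upperTriangular K n) k,
        ∀ b ∈ derivedSeries (upperTriangular K n) k,
        IsUpperBand (k + 1) ((⁅a, b⁆.1 : Matrix (Fin n) (Fin n) K) - 1) := by
      intro a ha b hb
      -- `⁅a, b⁆ - 1 = (a * b - b * a) * (b * a)⁻¹`, and `a * b - b * a` is the ring commutator of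
      -- `a - 1` and `b - 1`.
      have h1 := ((ih a ha).mul_sub_mul (ih b hb)).mul (isUpperBand_zero (b * a)⁻¹)
      rw [add_zero] at h1
      convert h1 using 1
      have h2 : (((b * a).1 : Matrix (Fin n) (Fin n) K)) * ((b * a)⁻¹).1 = 1 := by
        rw [← Units.val_mul, ← Subgroup.coe_mul, mul_inv_cancel]
        rfl
      have h3 : (⁅a, b⁆.1 : Matrix (Fin n) (Fin n) K) = ((a * b).1 : Matrix (Fin n) (Fin n) K) *
          ((b * a)⁻¹).1 := by
        rw [← Units.val_mul, ← Subgroup.coe_mul, commutatorElement_def]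
        congr 2
        group
      have h4 : ((a.1 : Matrix (Fin n) (Fin n) K) - 1) * ((b.1 : Matrix (Fin n) (Fin n) K) - 1) -
          ((b.1 : Matrix (Fin n) (Fin n) K) - 1) * ((a.1 : Matrix (Fin n) (Fin n) K) - 1) =
          ((a * b).1 : Matrix (Fin n) (Fin n) K) - (b * a).1 := by
        rw [Subgroup.coe_mul, Subgroup.coe_mul, Units.val_mul, Units.val_mul]
        noncomm_ring
      rw [h4, sub_mul, h2, h3]
    let H : Subgroup (upperTriangular K n) :=
      { carrier := {g | IsUpperBand (k + 1) ((g.1 : Matrix (Fin n) (Fin n) K) - 1)}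
        one_mem' := by
          intro i j _
          simp
        mul_mem' := by
          intro a b ha hb
          have h1 := (IsUpperBand.mul ha (isUpperBand_zero b)).add hb
          rwa [sub_mul, one_mul, sub_add_sub_cancel] at h1
        inv_mem' := by
          intro a ha
          have h1 := IsUpperBand.sub (M := 0) (fun _ _ _ => rfl)
            (IsUpperBand.mul ha (isUpperBand_zero a⁻¹))
          have h2 : ((a.1 : Matrix (Fin n) (Fin n) K)) * (a⁻¹).1 = 1 := by
            rw [← Units.val_mul, ← Subgroup.coe_mul, mul_inv_cancel]
            rfl
          rwa [sub_mul, h2, one_mul, zero_sub, neg_sub] at h1 }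
    rw [derivedSeries_succ] at hg
    exact (Subgroup.commutator_le (H₃ := H)).2 hcomm hg

theorem isSolvable_upperTriangular : Group.IsSolvable (upperTriangular K n) := by
  refine ⟨n, ?_⟩
  rw [eq_bot_iff]
  intro g hg
  rw [Subgroup.mem_bot]
  apply Subtype.ext
  apply Units.ext
  ext i j
  -- At band index `n` the condition `j < i + n` holds for all entries, so `g - 1` vanishes.
  have := isUpperBand_derivedSeries n g hg i j (by omega)
  exact sub_eq_zero.1 this

end UpperTriangular

/-! ### Scalar matrices inside the upper triangular group -/

section ScalarMatrices

variable (K : Type u) [Field K] (n : ℕ)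

/-- The invertible scalar matrices, as upper triangular matrices. -/
def scalarUpperTriangular : Kˣ →* upperTriangular K n :=
  (Units.map (Matrix.scalar (Fin n) : K →+* Matrix (Fin n) (Fin n) K).toMonoidHom).codRestrict _
    fun _ _ _ hij => Matrix.diagonal_apply_ne _ hij.ne'

variable {K n}

theorem scalarUpperTriangular_injective (hn : 0 < n) :
    Function.Injective (scalarUpperTriangular K n) := by
  intro a b h
  have h1 := congrArg (fun g : upperTriangular K n =>
    (g.1 : Matrix (Fin n) (Fin n) K) ⟨0, hn⟩ ⟨0, hn⟩) h
  apply Units.ext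
  simpa [scalarUpperTriangular] using h1

theorem upperTriangularAction_scalar (c : Kˣ) (v : Fin n → K) :
    upperTriangularAction K n (scalarUpperTriangular K n c) v = (c : K) • v := by
  change (Matrix.scalar (Fin n) (c : K)).mulVec v = _
  simp

end ScalarMatrices

end AlgEntropy

theorem mainTheorem8 (K : Type u) [Field K] [Infinite K] :
    (∀ n : ℕ, 0 < n →
      AlgEntropy.EntropyDefined.{u, u, w} (AlgEntropy.upperTriangularAction K n) ∧
      AlgEntropy.algEntropy (AlgEntropy.upperTriangularAction K n) = 0) ∧
    (AlgEntropy.EntropyDefined.{u, u, w} (AlgEntropy.multiplicationAction K) ∧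
      AlgEntropy.algEntropy (AlgEntropy.multiplicationAction K) = 0) := by
  refine ⟨fun n hn => ?_, ?_⟩
  · have := AlgEntropy.isSolvable_upperTriangular (K := K) (n := n)
    have hinj := AlgEntropy.scalarUpperTriangular_injective (K := K) hn
    exact AlgEntropy.entropyDefined_and_algEntropy_eq_zero AlgEntropy.folnerCondition_of_isSolvable
      (fun _ => AlgEntropy.isEntropyLimit_zero_of_scalars _ _ hinj
        AlgEntropy.upperTriangularAction_scalar)
      (fun _ => AlgEntropy.isEntropyLimit_zero_of_scalars _ _ hinj
        AlgEntropy.upperTriangularAction_scalar)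
  · exact AlgEntropy.entropyDefined_and_algEntropy_eq_zero AlgEntropy.folnerCondition_of_comm
      (fun _ => AlgEntropy.isEntropyLimit_zero_of_scalars _ (MonoidHom.id Kˣ)
        Function.injective_id fun _ _ => rfl)
      (fun _ => AlgEntropy.isEntropyLimit_zero_of_scalars _ (MonoidHom.id Kˣ)
        Function.injective_id fun _ _ => rfl)
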